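/- Let $P=(A,\mathcal C)$ be a political structure: a finite set $A$ of agents together with a collection $\mathcal C$ of nonempty subsets of $A$ (the viable configurations) that contains every singleton and every nonempty subset of each of its members; that is, a finite abstract simplicial complex with vertex set $A$. Fix any linear order on $A$, let $C_n(P)$ be the free abelian group on the $n$-simplices of $P$ (viable configurations with $n+1$ agents), with $C_{-1}(P)=\mathbb Z$, and let $$\partial_n[v_0,\dots,v_n]=\sum_{i=0}^n(-1)^i[v_0,\dots,\widehat{v_i},\dots,v_n]\qquad(v_0<\dots<v_n),$$ where $\partial_0$ is the sum of the coefficients. For $n\ge 0$ let $\beta_n$ be the rank of the reduced homology group $H_n(P)=\ker\partial_n/\operatorname{im}\partial_{n+1}$. An agent $b$ is dominated by an agent $a\neq b$ in a simplicial complex if every maximal simplex that contains $b$ also contains $a$. In this case the friendly delegation from $b$ to $a$ deletes $b$ from the complex, i.e. removes all simplices that contain $b$. The structure $P$ has a $D$-compromise (delegated compromise) if some finite sequence of friendly delegations, each performed in the complex left by the preceding ones, reduces $P$ to a single viable configuration (a simplex together with all its nonempty faces). It has an $R$-compromise (represented compromise) if there is such a sequence in which no agent that has been delegated to delegates in turn.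 **Proposition.** If $\beta_n\neq 0$ for some $n\ge 0$, then $P$ has neither an $R$-compromise nor a $D$-compromise. -/

import Mathlib

open scoped BigOperators

namespace PolStr

/-- A political structure on the set of agents `A` (to be taken finite) is an abstract simplicial
complex with vertex set `A`: the viable configurations are its (nonempty) simplices, every single
agent is viable, and every nonempty subset of a viable configuration is viable. -/
abbrev PoliticalStructure (A : Type*) := AbstractSimplicialComplex A

section Collapse

variable {A : Type*}

/-- Agent `b` is dominated by the other agent `a` in the complex `K`: both are vertices of `K`,
and every maximal simplex of `K` that contains `b` also contains `a`.
(The vertices of `K` are those `v` for which `{v}` is a simplex of `K`; after some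
agents have been deleted they are the remaining agents.) -/
def IsDominatedBy (K : PreAbstractSimplicialComplex A) (b a : A) : Prop :=
  b ≠ a ∧ {b} ∈ K ∧ {a} ∈ K ∧ ∀ σ : Finset A, Maximal (fun τ => τ ∈ K) σ → b ∈ σ → a ∈ σ

/-- The deletion `K ∖ b`: all simplices of `K` that do not contain `b`. -/
def deletion (K : PreAbstractSimplicialComplex A) (b : A) : PreAbstractSimplicialComplex A where
  faces := {σ | σ ∈ K ∧ b ∉ σ}
  isRelLowerSet_faces := by
    rintro σ ⟨hσ, hb⟩
    have h := K.isRelLowerSet_faces hσ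
    exact ⟨h.1, fun τ hτ hne => ⟨h.2 hτ hne, fun hbτ => hb (hτ hbτ)⟩⟩

/-- `DelegationSeq K l L`: the list `l = [(b₁, a₁), …, (bₘ, aₘ)]` is a sequence of friendly
delegations, `b₁` to `a₁`, then `b₂` to `a₂`, and so on, that starts at `K` and ends at `L`.
Each `bᵢ` is dominated by `aᵢ` in the complex that is left when `bᵢ` delegates, and the delegation
deletes `bᵢ` from it (an elementary strong collapse). -/
inductive DelegationSeq :
    PreAbstractSimplicialComplex A → List (A × A) → PreAbstractSimplicialComplex A → Prop
  | nil (K : PreAbstractSimplicialComplex A) : DelegationSeq K [] K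
  | cons {K L : PreAbstractSimplicialComplex A} {b a : A} {l : List (A × A)}
      (h : IsDominatedBy K b a) (hl : DelegationSeq (deletion K b) l L) :
      DelegationSeq K ((b, a) :: l) L

/-- All that is left is a viable configuration: one simplex of `K` contains all the others. -/
def IsSimplex (K : PreAbstractSimplicialComplex A) : Prop :=
  ∃ σ : Finset A, σ ∈ K ∧ ∀ τ : Finset A, τ ∈ K → τ ⊆ σ

/-- A delegated compromise: some sequence of friendly delegations, in which agents that have been
delegated to may delegate further, reduces `P` to a viable configuration. -/
def HasDCompromise (P : PoliticalStructure A) : Prop :=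
  ∃ (l : List (A × A)) (L : PreAbstractSimplicialComplex A),
    DelegationSeq P.toPreAbstractSimplicialComplex l L ∧ IsSimplex L

/-- A represented compromise: some sequence of friendly delegations, in which no agent that has
been delegated to delegates in turn, reduces `P` to a viable configuration. -/
def HasRCompromise (P : PoliticalStructure A) : Prop :=
  ∃ (l : List (A × A)) (L : PreAbstractSimplicialComplex A),
    DelegationSeq P.toPreAbstractSimplicialComplex l L ∧ IsSimplex L ∧
      ∀ d ∈ l, ∀ e ∈ l, d.2 ≠ e.1

end Collapse

section Homology

variable {A : Type*} [LinearOrder A]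

/-- The boundary of the simplex `σ = [v₀, …, vₙ]`, where `v₀ < ⋯ < vₙ`: the sum of
`(-1) ^ i [v₀, …, vᵢ₋₁, vᵢ₊₁, …, vₙ]`. The number of elements of `σ` below `v = vᵢ` is `i`.
The boundary of a vertex is the empty simplex, which is the generator of `C₋₁ = ℤ`. -/
noncomputable def simplexBoundary (σ : Finset A) : Finset A →₀ ℤ :=
  ∑ v ∈ σ, Finsupp.single (σ.erase v) ((-1 : ℤ) ^ (σ.filter (fun w => w < v)).card)

/-- The boundary operator, extended linearly to all formal sums of finite subsets of `A`. In degree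
zero it is the sum of the coefficients (times the empty simplex). -/
noncomputable def boundary : (Finset A →₀ ℤ) →ₗ[ℤ] (Finset A →₀ ℤ) :=
  Finsupp.linearCombination ℤ simplexBoundary

/-- `Cₙ(K)`, for `n ≥ 0`: the free abelian group on the `n`-simplices of `K`, each with the
orientation given by the order of the vertices. -/
noncomputable def chains (K : PreAbstractSimplicialComplex A) (n : ℕ) :
    Submodule ℤ (Finset A →₀ ℤ) :=
  Finsupp.supported ℤ ℤ {σ : Finset A | σ ∈ K ∧ σ.card = n + 1}

/-- The `n`-cycles `Zₙ(K) = ker ∂ₙ`. -/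
noncomputable def cycles (K : PreAbstractSimplicialComplex A) (n : ℕ) :
    Submodule ℤ (Finset A →₀ ℤ) :=
  chains K n ⊓ LinearMap.ker boundary

/-- The `n`-boundaries `Bₙ(K) = im ∂ₙ₊₁`. -/
noncomputable def boundaries (K : PreAbstractSimplicialComplex A) (n : ℕ) :
    Submodule ℤ (Finset A →₀ ℤ) :=
  (chains K (n + 1)).map boundary

theorem boundary_simplexBoundary (σ : Finset A) : boundary (simplexBoundary σ) = 0 := by
  set f : A → A → (Finset A →₀ ℤ) := fun v w =>
    Finsupp.single ((σ.erase v).erase w)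
      ((-1 : ℤ) ^ (σ.filter (fun u => u < v)).card *
        (-1 : ℤ) ^ ((σ.erase v).filter (fun u => u < w)).card) with hf
  have key : ∀ v ∈ σ, ∀ w ∈ σ, v < w → f v w = - f w v := by
    intro v hv w hw hvw
    have h1 : (σ.erase v).filter (fun u => u < w) = (σ.filter (fun u => u < w)).erase v := by
      ext u; simp only [Finset.mem_filter, Finset.mem_erase]; tauto
    have h2 : (σ.erase w).filter (fun u => u < v) = σ.filter (fun u => u < v) := by
      ext u
      simp only [Finset.mem_filter, Finset.mem_erase]
      exact ⟨fun h => ⟨h.1.2, h.2⟩, fun h => ⟨⟨(h.2.trans hvw).ne, h.1⟩, h.2⟩⟩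
    have h3 : ((σ.filter (fun u => u < w)).erase v).card + 1 =
        (σ.filter (fun u => u < w)).card :=
      Finset.card_erase_add_one (by simp [hv, hvw])
    simp only [hf, h1, h2, Finset.erase_right_comm (a := w) (b := v), ← h3,
      ← Finsupp.single_neg]
    congr 1
    ring
  have anti : ∀ v ∈ σ, ∀ w ∈ σ, v ≠ w → f v w = - f w v := by
    intro v hv w hw hvw
    rcases lt_or_gt_of_ne hvw with h | h
    · exact key v hv w hw h
    · rw [key w hw v hv h, neg_neg]
  have hS : boundary (simplexBoundary σ) =
      ∑ v ∈ σ, ∑ w ∈ σ, if v ≠ w then f v w else 0 := by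
    simp only [simplexBoundary, map_sum, boundary, Finsupp.linearCombination_single]
    refine Finset.sum_congr rfl fun v hv => ?_
    rw [Finset.smul_sum, ← Finset.sum_filter]
    refine Finset.sum_congr ?_ fun w _ => by simp [hf]
    ext u; simp only [Finset.mem_erase, Finset.mem_filter]; tauto
  have hneg : boundary (simplexBoundary σ) = - boundary (simplexBoundary σ) := by
    conv_rhs => rw [hS, Finset.sum_comm]
    rw [hS, ← Finset.sum_neg_distrib]
    refine Finset.sum_congr rfl fun v hv => ?_
    rw [← Finset.sum_neg_distrib]
    refine Finset.sum_congr rfl fun w hw => ?_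
    by_cases h : v = w
    · simp [h]
    · rw [if_pos h, if_pos (Ne.symm h), anti v hv w hw h]
  exact self_eq_neg.mp hneg

/-- Every boundary is a cycle. -/
theorem boundaries_le_cycles (K : PreAbstractSimplicialComplex A) (n : ℕ) :
    boundaries K n ≤ cycles K n := by
  rw [boundaries, chains, Finsupp.supported_eq_span_single, Submodule.map_span,
    Submodule.span_le]
  rintro _ ⟨_, ⟨σ, ⟨hσ, hc⟩, rfl⟩, rfl⟩
  have hb : boundary (Finsupp.single σ (1 : ℤ)) = simplexBoundary σ := by
    simp [boundary]
  rw [hb]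
  refine ⟨Submodule.sum_mem _ fun v hv => Finsupp.single_mem_supported ℤ _ ⟨?_, ?_⟩,
    boundary_simplexBoundary σ⟩
  · refine (K.isRelLowerSet_faces hσ).2 (Finset.erase_subset v σ) ?_
    rw [← Finset.card_pos, Finset.card_erase_of_mem hv]; omega
  · rw [Finset.card_erase_of_mem hv]; omega

/-- The reduced homology group `Hₙ(K) = Zₙ(K) / Bₙ(K)`, for `n ≥ 0`. -/
abbrev ReducedHomology (K : PreAbstractSimplicialComplex A) (n : ℕ) : Type _ :=
  cycles K n ⧸ (boundaries K n).submoduleOf (cycles K n)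

/-- The `n`th Betti number of a political structure: the rank of its reduced homology. -/
noncomputable def bettiNumber (P : PoliticalStructure A) (n : ℕ) : ℕ :=
  Module.finrank ℤ (ReducedHomology P.toPreAbstractSimplicialComplex n)

end Homology

end PolStr

/-!
Everything rests on the cone operator `cone a`, which joins a simplex not containing the agent `a`
with `a`. It is a contracting homotopy of the full augmented simplicial chain complex:
`∂ ∘ cone a + cone a ∘ ∂ = id` (`boundary_cone_add_cone_boundary`).

A simplex is therefore acyclic: coning from one of its vertices stays inside it, so a cycle `z` is
the boundary of `cone a z` (`IsSimplex.cycles_le_boundaries`).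

If `b` is dominated by `a` in `K`, acyclicity passes from `deletion K b` to `K`
(`IsDominatedBy.cycles_le_boundaries`). Split a cycle of `K` as `z = x + y`, where `y` collects the
simplices that contain `b`. Domination puts `cone a y` in `K`, and by the homotopy identity
`z - ∂ (cone a y) = x + cone a (∂ y)`. Since `∂ y = - ∂ x`, no simplex of `∂ y` contains `b`, so the
right-hand side is a cycle of `deletion K b`, homologous to `z` in `K`.

Going back along a sequence of delegations that ends in a simplex, every cycle of the original
structure bounds, so all its reduced Betti numbers vanish.
-/

namespace PolStr

/-! ### The cone operator -/

section Cone

variable {A : Type*}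

/-- A linear map given on the basis maps chains supported on `S` into `M` as soon as it maps the
simplices in `S` into `M`. -/
theorem linearCombination_mem_of_mem_supported {f : Finset A → (Finset A →₀ ℤ)}
    {S : Set (Finset A)} {M : Submodule ℤ (Finset A →₀ ℤ)} (hf : ∀ σ ∈ S, f σ ∈ M)
    {z : Finset A →₀ ℤ} (hz : z ∈ Finsupp.supported ℤ ℤ S) :
    Finsupp.linearCombination ℤ f z ∈ M := by
  rw [Finsupp.linearCombination_apply]
  exact Submodule.sum_mem _ fun σ hσ => M.smul_mem _ (hf σ ((Finsupp.mem_supported ℤ z).1 hz hσ))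

variable [LinearOrder A]

/-- The cone with apex `a` over the simplex `σ`: the simplex `insert a σ`, with the sign that `σ`
has in its boundary, or `0` if `a` already belongs to `σ`. The cone over the empty simplex is the
vertex `a`. -/
noncomputable def simplexCone (a : A) (σ : Finset A) : Finset A →₀ ℤ :=
  if a ∈ σ then 0
  else Finsupp.single (insert a σ) ((-1 : ℤ) ^ (σ.filter (fun w => w < a)).card)

/-- The cone operator with apex `a`, extended linearly to all formal sums of finite subsets. -/
noncomputable def cone (a : A) : (Finset A →₀ ℤ) →ₗ[ℤ] (Finset A →₀ ℤ) :=
  Finsupp.linearCombination ℤ (simplexCone a)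

theorem boundary_single (σ : Finset A) (c : ℤ) :
    boundary (Finsupp.single σ c) = c • simplexBoundary σ := by
  simp [boundary]

theorem cone_single (a : A) (σ : Finset A) (c : ℤ) :
    cone a (Finsupp.single σ c) = c • simplexCone a σ := by
  simp [cone]

theorem simplexCone_of_mem {a : A} {σ : Finset A} (h : a ∈ σ) : simplexCone a σ = 0 :=
  if_pos h

theorem simplexCone_of_notMem {a : A} {σ : Finset A} (h : a ∉ σ) :
    simplexCone a σ =
      Finsupp.single (insert a σ) ((-1 : ℤ) ^ (σ.filter (fun w => w < a)).card) :=
  if_neg h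

/-- Adding `a` to `σ` and removing `v` from it in either order gives opposite signs: exactly one of
the two positions involved is shifted by one. -/
theorem sign_insert_mul_sign {a v : A} {σ : Finset A} (ha : a ∉ σ) (hv : v ∈ σ) :
    (-1 : ℤ) ^ (σ.filter (fun w => w < a)).card *
        (-1 : ℤ) ^ ((insert a σ).filter (fun w => w < v)).card =
      -((-1 : ℤ) ^ (σ.filter (fun w => w < v)).card *
        (-1 : ℤ) ^ ((σ.erase v).filter (fun w => w < a)).card) := by
  rw [Finset.filter_insert, Finset.filter_erase]
  rcases lt_or_gt_of_ne (ne_of_mem_of_not_mem hv ha) with h | h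
  · rw [if_neg h.not_gt,
      ← Finset.card_erase_add_one (s := σ.filter (fun w => w < a)) (a := v) (by simp [hv, h])]
    ring
  · rw [if_pos h, Finset.card_insert_of_notMem (by simp [ha]),
      Finset.erase_eq_of_notMem (s := σ.filter (fun w => w < a)) (by simp [h.not_gt])]
    ring

theorem boundary_simplexCone_add_cone_simplexBoundary (a : A) (σ : Finset A) :
    boundary (simplexCone a σ) + cone a (simplexBoundary σ) = Finsupp.single σ 1 := by
  simp only [simplexBoundary, map_sum, cone_single]
  by_cases ha : a ∈ σ
  · -- Only the face opposite to `a` contributes.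
    rw [simplexCone_of_mem ha, map_zero, zero_add, Finset.sum_eq_single_of_mem a ha,
      simplexCone_of_notMem (Finset.notMem_erase a σ), Finset.filter_erase,
      Finset.erase_eq_of_notMem (s := σ.filter (fun w => w < a)) (by simp),
      Finset.insert_erase ha, Finsupp.smul_single, smul_eq_mul, ← mul_pow]
    · simp
    · intro v _ hva
      rw [simplexCone_of_mem (Finset.mem_erase.2 ⟨hva.symm, ha⟩), smul_zero]
  · -- The face of `insert a σ` opposite to `a` is `σ`; the other faces cancel.
    rw [simplexCone_of_notMem ha, boundary_single, simplexBoundary, Finset.sum_insert ha,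
      smul_add, Finset.smul_sum, add_assoc, ← Finset.sum_add_distrib, Finset.sum_eq_zero,
      add_zero, Finset.erase_insert ha, Finset.filter_insert, if_neg (lt_irrefl a),
      Finsupp.smul_single, smul_eq_mul, ← mul_pow]
    · simp
    · intro v hv
      rw [simplexCone_of_notMem (fun h => ha (Finset.mem_of_mem_erase h)), Finsupp.smul_single,
        Finsupp.smul_single, smul_eq_mul, smul_eq_mul,
        Finset.erase_insert_of_ne (ne_of_mem_of_not_mem hv ha).symm, ← Finsupp.single_add,
        sign_insert_mul_sign ha hv, neg_add_cancel, Finsupp.single_zero]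

/-- The cone operator is a contracting homotopy of the full augmented chain complex. -/
theorem boundary_cone_add_cone_boundary (a : A) (z : Finset A →₀ ℤ) :
    boundary (cone a z) + cone a (boundary z) = z := by
  have h : boundary ∘ₗ cone a + cone a ∘ₗ boundary = LinearMap.id := by
    ext1 σ
    ext1
    simpa [cone_single, boundary_single] using boundary_simplexCone_add_cone_simplexBoundary a σ
  exact LinearMap.congr_fun h z

theorem boundary_mem_supported {S T : Set (Finset A)} (h : ∀ σ ∈ S, ∀ v ∈ σ, σ.erase v ∈ T)
    {z : Finset A →₀ ℤ} (hz : z ∈ Finsupp.supported ℤ ℤ S) :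
    boundary z ∈ Finsupp.supported ℤ ℤ T :=
  linearCombination_mem_of_mem_supported (fun σ hσ => Submodule.sum_mem _ fun v hv =>
    Finsupp.single_mem_supported ℤ _ (h σ hσ v hv)) hz

theorem cone_mem_supported {a : A} {S T : Set (Finset A)}
    (h : ∀ σ ∈ S, a ∉ σ → insert a σ ∈ T)
    {z : Finset A →₀ ℤ} (hz : z ∈ Finsupp.supported ℤ ℤ S) :
    cone a z ∈ Finsupp.supported ℤ ℤ T := by
  refine linearCombination_mem_of_mem_supported (fun σ hσ => ?_) hz
  by_cases ha : a ∈ σ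
  · rw [simplexCone_of_mem ha]
    exact Submodule.zero_mem _
  · rw [simplexCone_of_notMem ha]
    exact Finsupp.single_mem_supported ℤ _ (h σ hσ ha)

end Cone

/-! ### Acyclicity of simplices and invariance under delegation -/

section Acyclic

variable {A : Type*} [LinearOrder A]

theorem boundaries_mono {K L : PreAbstractSimplicialComplex A} (h : ∀ σ ∈ K, σ ∈ L) (n : ℕ) :
    boundaries K n ≤ boundaries L n :=
  Submodule.map_mono (Finsupp.supported_mono fun σ hσ => ⟨h σ hσ.1, hσ.2⟩)

theorem IsSimplex.cycles_le_boundaries {K : PreAbstractSimplicialComplex A} (hK : IsSimplex K)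
    (n : ℕ) : cycles K n ≤ boundaries K n := by
  obtain ⟨σ, hσ, hmax⟩ := hK
  obtain ⟨a, ha⟩ := (K.isRelLowerSet_faces hσ).1
  rintro z ⟨hz, hz0⟩
  refine ⟨cone a z, cone_mem_supported ?_ hz, ?_⟩
  · rintro τ ⟨hτ, hc⟩ haτ
    exact ⟨(K.isRelLowerSet_faces hσ).2 (Finset.insert_subset ha (hmax τ hτ))
      (Finset.insert_nonempty a τ), by rw [Finset.card_insert_of_notMem haτ, hc]⟩
  · have h := boundary_cone_add_cone_boundary a z
    rwa [LinearMap.mem_ker.1 hz0, map_zero, add_zero] at h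

theorem IsDominatedBy.insert_mem [Finite A] {K : PreAbstractSimplicialComplex A} {b a : A}
    (h : IsDominatedBy K b a) {σ : Finset A} (hσ : σ ∈ K) (hb : b ∈ σ) : insert a σ ∈ K := by
  obtain ⟨τ, hστ, hτ⟩ := (Set.toFinite {τ : Finset A | τ ∈ K}).exists_le_maximal hσ
  exact (K.isRelLowerSet_faces hτ.prop).2
    (Finset.insert_subset (h.2.2.2 τ hτ (hστ hb)) hστ) (Finset.insert_nonempty a σ)

/-- Acyclicity in degree `n` passes from the deletion of a dominated agent to the whole complex. -/
theorem IsDominatedBy.cycles_le_boundaries [Finite A] {K : PreAbstractSimplicialComplex A}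
    {b a : A} (h : IsDominatedBy K b a) {n : ℕ}
    (hdel : cycles (deletion K b) n ≤ boundaries (deletion K b) n) :
    cycles K n ≤ boundaries K n := by
  rintro z ⟨hz, hz0⟩
  have hz0 : boundary z = 0 := hz0
  set y := z.filter (fun σ => b ∈ σ) with hy
  set x := z.filter (fun σ => b ∉ σ) with hx
  have hyx : y + x = z := Finsupp.filter_add_filter_not z _
  have hzmem : ∀ σ ∈ z.support, σ ∈ K ∧ σ.card = n + 1 := (Finsupp.mem_supported ℤ z).1 hz
  have hys : y ∈ Finsupp.supported ℤ ℤ {σ | (σ ∈ K ∧ σ.card = n + 1) ∧ b ∈ σ} := by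
    intro σ hσ
    rw [hy, Finset.mem_coe, Finsupp.support_filter, Finset.mem_filter] at hσ
    exact ⟨hzmem σ hσ.1, hσ.2⟩
  have hxs : x ∈ Finsupp.supported ℤ ℤ {σ | (σ ∈ K ∧ b ∉ σ) ∧ σ.card = n + 1} := by
    intro σ hσ
    rw [hx, Finset.mem_coe, Finsupp.support_filter, Finset.mem_filter] at hσ
    exact ⟨⟨(hzmem σ hσ.1).1, hσ.2⟩, (hzmem σ hσ.1).2⟩
  have hcy : cone a y ∈ chains K (n + 1) := by
    refine cone_mem_supported ?_ hys
    rintro σ ⟨⟨hσ, hc⟩, hb⟩ ha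
    exact ⟨h.insert_mem hσ hb, by rw [Finset.card_insert_of_notMem ha, hc]⟩
  -- For `n = 0` the chain `∂ y` is a multiple of the empty simplex, which is not a member of `K`,
  -- so membership in `K` is recorded only after `a` has been added.
  have hdy : boundary y ∈ Finsupp.supported ℤ ℤ {ρ | insert a ρ ∈ K ∧ ρ.card = n} := by
    refine boundary_mem_supported ?_ hys
    rintro σ ⟨⟨hσ, hc⟩, hb⟩ v hv
    refine ⟨(K.isRelLowerSet_faces (h.insert_mem hσ hb)).2
      (Finset.insert_subset_insert a (Finset.erase_subset v σ)) (Finset.insert_nonempty a _), ?_⟩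
    rw [Finset.card_erase_of_mem hv, hc, Nat.add_sub_cancel]
  have hdy' : boundary y ∈ Finsupp.supported ℤ ℤ {ρ : Finset A | b ∉ ρ} := by
    have hneg : boundary y = -boundary x := by
      rw [eq_neg_iff_add_eq_zero, ← map_add, hyx, hz0]
    rw [hneg]
    refine Submodule.neg_mem _ (boundary_mem_supported ?_ hxs)
    exact fun σ hσ v _ hb => hσ.1.2 (Finset.mem_of_mem_erase hb)
  have hcdy : cone a (boundary y) ∈ chains (deletion K b) n := by
    refine cone_mem_supported (S := {ρ | insert a ρ ∈ K ∧ ρ.card = n} ∩ {ρ | b ∉ ρ}) ?_ ?_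
    · rintro ρ ⟨⟨hρ, hc⟩, hb⟩ ha
      refine ⟨⟨hρ, ?_⟩, by rw [Finset.card_insert_of_notMem ha, hc]⟩
      rw [Finset.mem_insert, not_or]
      exact ⟨h.1, hb⟩
    · rw [Finsupp.supported_inter]
      exact ⟨hdy, hdy'⟩
  have hsplit : z = boundary (cone a y) + (x + cone a (boundary y)) := by
    calc z = y + x := hyx.symm
      _ = boundary (cone a y) + cone a (boundary y) + x := by
        rw [boundary_cone_add_cone_boundary]
      _ = _ := by abel
  have hcyc : x + cone a (boundary y) ∈ cycles (deletion K b) n := by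
    refine ⟨Submodule.add_mem _ hxs hcdy, ?_⟩
    have hcy0 : boundary (boundary (cone a y)) = 0 :=
      (boundaries_le_cycles K n ⟨_, hcy, rfl⟩).2
    have h0 := congrArg boundary hsplit
    rw [hz0, map_add, hcy0, zero_add] at h0
    exact h0.symm
  rw [hsplit]
  exact Submodule.add_mem _ ⟨_, hcy, rfl⟩ (boundaries_mono (K := deletion K b) (fun σ hσ => hσ.1) n (hdel hcyc))

theorem DelegationSeq.cycles_le_boundaries [Finite A] {K L : PreAbstractSimplicialComplex A}
    {l : List (A × A)} (h : DelegationSeq K l L) (hL : IsSimplex L) (n : ℕ) :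
    cycles K n ≤ boundaries K n := by
  induction h with
  | nil K => exact hL.cycles_le_boundaries n
  | cons h _ ih => exact h.cycles_le_boundaries (ih hL)

theorem bettiNumber_eq_zero_of_hasDCompromise [Finite A] {P : PoliticalStructure A}
    (h : HasDCompromise P) (n : ℕ) : bettiNumber P n = 0 := by
  obtain ⟨l, L, hl, hL⟩ := h
  have htop : (boundaries P.toPreAbstractSimplicialComplex n).submoduleOf
      (cycles P.toPreAbstractSimplicialComplex n) = ⊤ :=
    Submodule.submoduleOf_eq_top.2 (hl.cycles_le_boundaries hL n)
  have : Subsingleton (ReducedHomology P.toPreAbstractSimplicialComplex n) :=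
    Submodule.Quotient.subsingleton_iff.2 htop
  exact Module.finrank_zero_of_subsingleton

theorem HasRCompromise.hasDCompromise {A : Type*} {P : PoliticalStructure A}
    (h : HasRCompromise P) : HasDCompromise P := by
  obtain ⟨l, L, hl, hL, _⟩ := h
  exact ⟨l, L, hl, hL⟩

end Acyclic

end PolStr

theorem mainTheorem6 {A : Type*} [Finite A] [LinearOrder A] (P : PolStr.PoliticalStructure A)
    (hP : ∃ n : ℕ, PolStr.bettiNumber P n ≠ 0) :
    ¬ PolStr.HasRCompromise P ∧ ¬ PolStr.HasDCompromise P := by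
  obtain ⟨n, hn⟩ := hP
  have hD : ¬ PolStr.HasDCompromise P := fun h =>
    hn (PolStr.bettiNumber_eq_zero_of_hasDCompromise h n)
  exact ⟨fun h => hD h.hasDCompromise, hD⟩
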